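/- Let $n \ge 1$ and let $K_{2n}$ be the complete graph on $2n$ vertices. A perfect matching of $K_{2n}$ is a $1$-regular subgraph containing all the vertices. Let $\mathcal{F}$ be a family (set) of perfect matchings of $K_{2n}$ that is intersecting, i.e. any two members of $\mathcal{F}$ have an edge in common. Then $|\mathcal{F}| \le (2(n-1)-1)!!$, where $k!! = k(k-2)(k-4)\cdots 1$ for odd $k \ge 1$ and $(-1)!! = 1$. Moreover, $|\mathcal{F}| = (2(n-1)-1)!!$ if and only if there are two distinct vertices $i \ne j$ of $K_{2n}$ such that $\mathcal{F} = \mathcal{F}_{ij}$, the family of all perfect matchings of $K_{2n}$ that contain the edge $ij$. -/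

import Mathlib

/-- `PerfMatching n` is the type of perfect matchings of the complete graph on the `2 * n`
vertices `Fin (2 * n)`: subgraphs that contain every vertex and in which every vertex has
exactly one neighbour. -/
abbrev PerfMatching (n : ℕ) : Type :=
  {m : (⊤ : SimpleGraph (Fin (2 * n))).Subgraph // m.IsPerfectMatching}

/-- A family of perfect matchings is intersecting if every two of its members share an edge. -/
def IsIntersectingFamily {n : ℕ} (F : Finset (PerfMatching n)) : Prop :=
  ∀ m ∈ F, ∀ m' ∈ F, (m.1.edgeSet ∩ m'.1.edgeSet).Nonempty

/-- The set of all perfect matchings that contain the edge `ij`. -/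
def matchingsThrough {n : ℕ} (i j : Fin (2 * n)) : Set (PerfMatching n) :=
  {m | s(i, j) ∈ m.1.edgeSet}

/-! The bound is a Katona-style average. A one-factorization `C` has `2n - 1` pairwise disjoint
matchings, so an intersecting `F` contains at most one member of each conjugate of `C`. Over all
conjugations every matching is hit equally often, hence `(2n - 1)|F|` is at most `(2n - 1)!!`, the
number of all matchings. In case of equality `F` meets every one-factorization
(`IsIntersecting.exists_mem_of_card_eq`).

The equality case uses that, for `n ≥ 3`, any two disjoint matchings lie in a common
one-factorization (`exists_isOneFactorization`). Let `n ≥ 4`, and suppose `g ∈ F` but switching its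
edges at `a` and `b` leads out of `F`. Then every `m ∈ F` contains one of these two edges. Otherwise
some `h` shares exactly these two edges with `g` and is disjoint from `m`; take a one-factorization
through `g` and the switch of `h`, and replace this pair by the switch of `g` and `h`. The result
misses `F`, a contradiction. A minimality argument supplies such a switch, and a second use of the
dichotomy leaves one edge common to all of `F`. The cases `n ≤ 3` are treated directly. -/

namespace PerfectMatchingEKR

open Finset Equiv

/-- A perfect matching of the complete graph on `V`, encoded as the fixed-point-free involution
that sends each vertex to its partner. -/
def IsMatching {V : Type*} (g : Perm V) : Prop := ∀ v, g (g v) = v ∧ g v ≠ v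

/-- Two permutations that agree nowhere. -/
def Avoids {V : Type*} (g h : Perm V) : Prop := ∀ v, g v ≠ h v

theorem Avoids.symm {V : Type*} {g h : Perm V} (H : Avoids g h) : Avoids h g :=
  fun v => (H v).symm

/-- A set of `2n - 1` pairwise edge-disjoint perfect matchings. -/
structure IsOneFactorization {V : Type*} (n : ℕ) (C : Finset (Perm V)) : Prop where
  isMatching : ∀ g ∈ C, IsMatching g
  avoids : ∀ g ∈ C, ∀ h ∈ C, g ≠ h → Avoids g h
  card_eq : C.card = 2 * n - 1

/-! ### Latin squares -/

/-- Hall's theorem: in the bipartite graph of values still allowed, every vertex on either side has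
degree `|α| - |R| > 0`. -/
theorem exists_perm_avoids {α : Type*} [Fintype α] [DecidableEq α] (R : Finset (Perm α))
    (hR : ∀ π ∈ R, ∀ ρ ∈ R, π ≠ ρ → Avoids π ρ) (hcard : R.card < Fintype.card α) :
    ∃ σ : Perm α, ∀ π ∈ R, Avoids σ π := by
  let t : α → Finset α := fun x => (R.image fun π => π x)ᶜ
  have hinj (x : α) : Set.InjOn (fun π : Perm α => π x) R := by
    intro π hπ ρ hρ h
    by_contra hne
    exact hR π hπ ρ hρ hne x h
  have hinj' (y : α) : Set.InjOn (fun π : Perm α => π.symm y) R := by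
    intro π hπ ρ hρ h
    by_contra hne
    refine hR π hπ ρ hρ hne (π.symm y) ?_
    have h' : π.symm y = ρ.symm y := h
    rw [apply_symm_apply, h', apply_symm_apply]
  have ht (x : α) : (t x).card = Fintype.card α - R.card := by
    rw [card_compl, card_image_of_injOn (hinj x)]
  have hall : ∀ A : Finset α, A.card ≤ (A.biUnion t).card := by
    intro A
    have key := Finset.card_mul_le_card_mul (s := A) (t := A.biUnion t) (fun x y => y ∈ t x)
      (m := Fintype.card α - R.card) (n := Fintype.card α - R.card) ?_ ?_
    · exact Nat.le_of_mul_le_mul_right key (by omega)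
    · intro x hx
      rw [← ht x]
      apply card_le_card
      intro y hy
      rw [mem_bipartiteAbove]
      exact ⟨mem_biUnion.2 ⟨x, hx, hy⟩, hy⟩
    · intro y _
      rw [← card_image_of_injOn (hinj' y), ← card_compl]
      apply card_le_card
      intro x hx
      rw [mem_bipartiteBelow] at hx
      simp only [t, mem_compl, mem_image, not_exists, not_and] at hx ⊢
      intro π hπ h
      exact hx.2 π hπ (by rw [← h, apply_symm_apply])
  obtain ⟨f, hf, hft⟩ := (Finset.all_card_le_biUnion_card_iff_exists_injective t).1 hall
  refine ⟨Equiv.ofBijective f (Finite.injective_iff_bijective.1 hf), fun π hπ x h => ?_⟩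
  have := hft x
  simp only [t, mem_compl, mem_image, not_exists, not_and] at this
  exact this π hπ h.symm

theorem exists_latin_extension {α : Type*} [Fintype α] [DecidableEq α] (k : ℕ)
    (R : Finset (Perm α)) (hR : ∀ π ∈ R, ∀ ρ ∈ R, π ≠ ρ → Avoids π ρ)
    (hcard : R.card + k = Fintype.card α) :
    ∃ L : Finset (Perm α), R ⊆ L ∧ (∀ π ∈ L, ∀ ρ ∈ L, π ≠ ρ → Avoids π ρ) ∧
      L.card = Fintype.card α := by
  induction k generalizing R with
  | zero => exact ⟨R, Subset.rfl, hR, by omega⟩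
  | succ k ih =>
    obtain ⟨σ, hσ⟩ := exists_perm_avoids R hR (by omega)
    have : Nonempty α := Fintype.card_pos_iff.1 (by omega)
    have hmem : σ ∉ R := fun h => hσ σ h (Classical.arbitrary α) rfl
    obtain ⟨L, h1, h2, h3⟩ := ih (insert σ R) (by
      intro π hπ ρ hρ hne
      rw [mem_insert] at hπ hρ
      rcases hπ with rfl | hπ <;> rcases hρ with rfl | hρ
      · exact absurd rfl hne
      · exact hσ _ hρ
      · exact (hσ _ hπ).symm
      · exact hR _ hπ _ hρ hne) (by rw [card_insert_of_notMem hmem]; omega)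
    exact ⟨L, (subset_insert _ _).trans h1, h2, h3⟩

/-! ### The union of two perfect matchings is bipartite -/

/-- Conjugation by `g` inverts `g * h`. If `(g * h) ^ k` sent `v` to `g v`, the point halfway along
would be fixed by `g` (`k` even) or by `h` (`k` odd). -/
theorem IsMatching.not_sameCycle {V : Type*} {g h : Perm V} (hg : IsMatching g)
    (hh : IsMatching h) (v : V) : ¬ (g * h).SameCycle v (g v) := by
  have hgg : g * g = 1 := by ext x; exact (hg x).1
  have hhh : h * h = 1 := by ext x; exact (hh x).1
  have hginv : g⁻¹ = g := inv_eq_of_mul_eq_one_left hgg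
  have hhinv : h⁻¹ = h := inv_eq_of_mul_eq_one_left hhh
  have hsemi : SemiconjBy g (g * h) (g * h)⁻¹ := by
    rw [SemiconjBy, mul_inv_rev, hginv, hhinv, ← mul_assoc, hgg, one_mul, mul_assoc, hgg, mul_one]
  have hconj (k : ℤ) (w : V) : g (((g * h) ^ k) w) = ((g * h) ^ (-k)) (g w) := by
    have := hsemi.zpow_right k
    rw [inv_zpow', SemiconjBy] at this
    exact congrArg (fun p : Perm V => p w) this
  rintro ⟨k, hk⟩
  obtain ⟨j, rfl | rfl⟩ := Int.even_or_odd' k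
  · refine (hg (((g * h) ^ j) v)).2 ?_
    rw [hconj, ← hk, ← Perm.mul_apply, ← zpow_add]
    congr 2; ring
  · refine (hh (((g * h) ^ j) v)).2 ?_
    have : h (((g * h) ^ j) v) = g (((g * h) ^ (j + 1)) v) := by
      rw [add_comm, zpow_add, zpow_one, Perm.mul_apply, Perm.mul_apply, (hg _).1]
    rw [this, hconj, ← hk, ← Perm.mul_apply, ← zpow_add]
    congr 2; ring

/-- Both `g` and `h` induce the same fixed-point-free involution on the cycles of `g * h`. An
arbitrary linear order on the cycles selects one from each pair. -/
theorem exists_bipartition {V : Type*} {g h : Perm V} (hg : IsMatching g) (hh : IsMatching h) :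
    ∃ s : V → Prop, ∀ v, (s (g v) ↔ ¬ s v) ∧ (s (h v) ↔ ¬ s v) := by
  classical
  let Q := Quotient (Perm.SameCycle.setoid (g * h))
  let q : V → Q := Quotient.mk _
  have hgg : g * g = 1 := by ext x; exact (hg x).1
  have hhh : h * h = 1 := by ext x; exact (hh x).1
  have hginv : g⁻¹ = g := inv_eq_of_mul_eq_one_left hgg
  have hhinv : h⁻¹ = h := inv_eq_of_mul_eq_one_left hhh
  have hq {v w : V} : q v = q w ↔ (g * h).SameCycle v w := Quotient.eq
  have hqg {v w : V} (e : q v = q w) : q (g v) = q (g w) := by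
    rw [hq] at e ⊢
    have := e.conj (g := g)
    rw [hginv] at this
    have e2 : g * (g * h) * g = (g * h)⁻¹ := by
      rw [mul_inv_rev, hginv, hhinv, ← mul_assoc, hgg, one_mul]
    rw [e2] at this
    exact Perm.sameCycle_inv.1 this
  have hqh (v : V) : q (h v) = q (g v) := by
    rw [hq]
    refine Perm.SameCycle.symm ⟨-1, ?_⟩
    rw [zpow_neg_one, mul_inv_rev, hginv, hhinv, Perm.mul_apply, (hg _).1]
  have hne (v : V) : q v ≠ q (g v) := fun e => hg.not_sameCycle hh v (hq.1 e)
  let _ : LinearOrder Q := linearOrderOfSTO WellOrderingRel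
  have hgs (v : V) : q (g v) < q (g (g v)) ↔ ¬ q v < q (g v) := by
    rw [(hg v).1, not_lt]
    exact ⟨le_of_lt, fun h => lt_of_le_of_ne h (hne v).symm⟩
  refine ⟨fun v => q v < q (g v), fun v => ⟨hgs v, ?_⟩⟩
  change q (h v) < q (g (h v)) ↔ _
  rw [← hgs v, hqg (hqh v), hqh v]

/-! ### One-factorizations of the complete graph -/

/-- The perfect matching of `α ⊕ α` that joins the left copy of `x` to the right copy of `π x`. -/
def crossMatching {α : Type*} (π : Perm α) : Perm (α ⊕ α) where
  toFun := Sum.elim (fun x => Sum.inr (π x)) (fun y => Sum.inl (π.symm y))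
  invFun := Sum.elim (fun x => Sum.inr (π x)) (fun y => Sum.inl (π.symm y))
  left_inv := by rintro (x | y) <;> simp
  right_inv := by rintro (x | y) <;> simp

@[simp] theorem crossMatching_inl {α : Type*} (π : Perm α) (x : α) :
    crossMatching π (Sum.inl x) = Sum.inr (π x) := rfl

@[simp] theorem crossMatching_inr {α : Type*} (π : Perm α) (y : α) :
    crossMatching π (Sum.inr y) = Sum.inl (π.symm y) := rfl

theorem isMatching_crossMatching {α : Type*} (π : Perm α) : IsMatching (crossMatching π) := by
  rintro (x | y) <;> simp

theorem avoids_crossMatching {α : Type*} {π ρ : Perm α} (h : Avoids π ρ) :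
    Avoids (crossMatching π) (crossMatching ρ) := by
  rintro (x | y)
  · simpa using h x
  · simp only [crossMatching_inr, ne_eq, Sum.inl.injEq]
    intro e
    apply h (π.symm y)
    rw [apply_symm_apply, e, apply_symm_apply]

theorem exists_eq_crossMatching {α : Type*} [Finite α] {k : Perm (α ⊕ α)} (hk : IsMatching k)
    (h : ∀ x, (k (Sum.inl x)).isRight) : ∃ π, k = crossMatching π := by
  have h' (x : α) : ∃ y, k (Sum.inl x) = Sum.inr y := Sum.isRight_iff.1 (h x)
  choose f hf using h'
  have hinj : Function.Injective f := by
    intro x x' e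
    have := hf x
    rw [e, ← hf x'] at this
    exact Sum.inl_injective (k.injective this)
  refine ⟨Equiv.ofBijective f (Finite.injective_iff_bijective.1 hinj), ?_⟩
  ext1 v
  rcases v with x | y
  · exact hf x
  · obtain ⟨x, rfl⟩ := (Finite.injective_iff_surjective.1 hinj) y
    rw [← hf x, (hk _).1, hf x, crossMatching_inr]
    congr 1
    exact (Equiv.ofBijective_symm_apply_apply f _ x).symm

section Fold

variable {α : Type*} [AddCommGroup α] [DecidableEq α]

/-- The perfect matching of `α ⊕ α` that reflects both copies of `α` by `x ↦ i - x` and joins each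
fixed point `x` on the left to `φ x` on the right. -/
def foldMatching (φ : Perm α) (i : α) : Perm (α ⊕ α) :=
  Function.Involutive.toPerm
    (Sum.elim (fun x => if i - x = x then Sum.inr (φ x) else Sum.inl (i - x))
      (fun y => if i - φ.symm y = φ.symm y then Sum.inl (φ.symm y)
        else Sum.inr (φ (i - φ.symm y)))) (by
    rintro (x | y)
    · by_cases h : i - x = x
      · simp [h]
      · simp [h, Ne.symm h]
    · by_cases h : i - φ.symm y = φ.symm y
      · simp [h]
      · simp [h, Ne.symm h])

theorem foldMatching_inl (φ : Perm α) (i x : α) : foldMatching φ i (Sum.inl x) =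
    if i - x = x then Sum.inr (φ x) else Sum.inl (i - x) := rfl

theorem foldMatching_inr (φ : Perm α) (i y : α) : foldMatching φ i (Sum.inr y) =
    if i - φ.symm y = φ.symm y then Sum.inl (φ.symm y) else Sum.inr (φ (i - φ.symm y)) := rfl

theorem isMatching_foldMatching (φ : Perm α) (i : α) : IsMatching (foldMatching φ i) := by
  intro v
  refine ⟨Function.Involutive.toPerm_involutive _ v, ?_⟩
  rcases v with x | y
  · rw [foldMatching_inl]
    split_ifs with h
    · simp
    · simpa using h
  · rw [foldMatching_inr]
    split_ifs with h
    · simp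
    · intro e
      exact h (φ.injective (by simpa using e))

/-- Each `x` is fixed by just one reflection, that with `i = x + x`, so each edge from `x` to `φ x`
is used for one `i` only. -/
theorem avoids_foldMatching (φ : Perm α) {i j : α} (hij : i ≠ j) :
    Avoids (foldMatching φ i) (foldMatching φ j) := by
  rintro (x | y)
  · rw [foldMatching_inl, foldMatching_inl]
    split_ifs with h h' h'
    · exact fun _ => hij (sub_left_injective (h.trans h'.symm))
    · simp
    · simp
    · simpa using hij
  · rw [foldMatching_inr, foldMatching_inr]
    split_ifs with h h' h'
    · exact fun _ => hij (sub_left_injective (h.trans h'.symm))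
    · simp
    · simp
    · simpa using hij

theorem avoids_foldMatching_crossMatching {φ π : Perm α} (h : Avoids φ π) (i : α) :
    Avoids (foldMatching φ i) (crossMatching π) := by
  rintro (x | y)
  · rw [foldMatching_inl, crossMatching_inl]
    split_ifs
    · simpa using h x
    · simp
  · rw [foldMatching_inr, crossMatching_inr]
    split_ifs
    · simp only [ne_eq, Sum.inl.injEq]
      intro e
      apply h (φ.symm y)
      rw [apply_symm_apply, e, apply_symm_apply]
    · simp

end Fold

theorem isOneFactorization_image {V ι : Type*} [Nonempty V] [DecidableEq (Perm V)] [Fintype ι]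
    (n : ℕ) (G : ι → Perm V) (hG : ∀ i, IsMatching (G i))
    (hGG : ∀ i j, i ≠ j → Avoids (G i) (G j)) (hι : Fintype.card ι = 2 * n - 1) :
    IsOneFactorization n (univ.image G) where
  isMatching := by simpa using hG
  avoids := by
    simp only [mem_image, mem_univ, true_and]
    rintro _ ⟨i, rfl⟩ _ ⟨j, rfl⟩ hne
    exact hGG i j fun h => hne (h ▸ rfl)
  card_eq := by
    rw [card_image_of_injective, card_univ, hι]
    intro i j h
    by_contra hne
    exact hGG i j hne (Classical.arbitrary V) (congrArg (fun p : Perm V => p _) h)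

theorem IsMatching.card_eq_of_bipartition {V : Type*} [Fintype V] {n : ℕ}
    (hV : Fintype.card V = 2 * n) {g : Perm V} (s : V → Prop) [DecidablePred s]
    (hs : ∀ v, s (g v) ↔ ¬ s v) :
    Fintype.card {v // s v} = n ∧ Fintype.card {v // ¬ s v} = n := by
  have e : {v // s v} ≃ {v // ¬ s v} := g.subtypeEquiv fun v => by rw [hs, not_not]
  have h1 := Fintype.card_congr e
  have h2 := Fintype.card_congr (Equiv.sumCompl s)
  rw [Fintype.card_sum] at h2
  omega

/-- Any two perfect matchings that are equal or disjoint lie in a common one-factorization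
(provided that `n` exceeds the number of matchings prescribed). -/
theorem exists_isOneFactorization {V : Type*} [Fintype V] [DecidableEq V] {n : ℕ}
    (hV : Fintype.card V = 2 * n) {g h : Perm V} (hg : IsMatching g) (hh : IsMatching h)
    (hgh : g ≠ h → Avoids g h) (hn : ({g, h} : Finset (Perm V)).card < n) :
    ∃ C : Finset (Perm V), IsOneFactorization n C ∧ g ∈ C ∧ h ∈ C := by
  classical
  have : NeZero n := ⟨by omega⟩
  obtain ⟨s, hs⟩ := exists_bipartition hg hh
  obtain ⟨c1, c2⟩ := IsMatching.card_eq_of_bipartition hV s fun v => (hs v).1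
  have hα : Fintype.card (ZMod n) = n := ZMod.card n
  let e1 : {v // s v} ≃ ZMod n := Fintype.equivOfCardEq (by rw [c1, hα])
  let e2 : {v // ¬ s v} ≃ ZMod n := Fintype.equivOfCardEq (by rw [c2, hα])
  let e : V ≃ ZMod n ⊕ ZMod n := (Equiv.sumCompl s).symm.trans (Equiv.sumCongr e1 e2)
  have hleft (x : ZMod n) : s (e.symm (Sum.inl x)) := (e1.symm x).2
  have hright (v : V) (hv : ¬ s v) : (e v).isRight := by
    simp [e, Equiv.sumCompl_symm_apply_of_neg hv]
  have hrow {k : Perm V} (hk : IsMatching k) (hks : ∀ v, s (k v) ↔ ¬ s v) :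
      ∃ π, e.permCongr k = crossMatching π := by
    apply exists_eq_crossMatching
    · intro v
      simp only [permCongr_apply, symm_apply_apply, (hk _).1, apply_symm_apply, true_and]
      intro h'
      exact (hk (e.symm v)).2 (e.injective (by rw [h', apply_symm_apply]))
    · intro x
      exact hright _ (by rw [Equiv.trans_apply, hks, not_not]; exact hleft x)
  obtain ⟨π, hπ⟩ := hrow hg fun v => (hs v).1
  obtain ⟨ρ, hρ⟩ := hrow hh fun v => (hs v).2
  have hinj : Function.Injective (crossMatching : Perm (ZMod n) → _) := by
    intro a b hab
    ext1 x
    exact Sum.inr_injective (congrArg (fun p : Perm _ => p (Sum.inl x)) hab)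
  have hπρ : π ≠ ρ → Avoids π ρ := by
    intro hne x hx
    have hgh' : g ≠ h := by
      rintro rfl
      exact hne (hinj (hπ.symm.trans hρ))
    apply hgh hgh' (e.symm (Sum.inl x))
    apply e.injective
    have h1 := congrArg (fun p : Perm _ => p (Sum.inl x)) hπ
    have h2 := congrArg (fun p : Perm _ => p (Sum.inl x)) hρ
    simp only [permCongr_apply, crossMatching_inl] at h1 h2
    rw [h1, h2, hx]
  have hcard : ({π, ρ} : Finset _).card < n := by
    refine lt_of_le_of_lt ?_ hn
    by_cases hgh' : g = h
    · subst hgh'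
      have : π = ρ := hinj (hπ.symm.trans hρ)
      subst this
      simp
    · rw [card_pair hgh']
      exact card_le_two
  obtain ⟨L, hL, hLL, hLc⟩ := exists_latin_extension (n - ({π, ρ} : Finset _).card)
    ({π, ρ} : Finset (Perm (ZMod n))) (by
      simp only [mem_insert, mem_singleton]
      rintro a (rfl | rfl) b (rfl | rfl) hab
      · exact absurd rfl hab
      · exact hπρ hab
      · exact (hπρ hab.symm).symm
      · exact absurd rfl hab) (by rw [hα]; omega)
  rw [hα] at hLc
  -- The row `φ` is sacrificed: its edges and those inside the two halves make up `n` fold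
  -- matchings, while the other `n - 1` rows stay, giving `2n - 1` in all. The bound `hn` leaves a
  -- row different from `π` and `ρ`.
  obtain ⟨φ, hφL, hφ⟩ := exists_mem_notMem_of_card_lt_card (hcard.trans_eq hLc.symm)
  let G : ZMod n ⊕ {σ // σ ∈ L.erase φ} → Perm V :=
    fun i => e.symm.permCongr (Sum.elim (foldMatching φ) (fun σ => crossMatching σ.1) i)
  have hmem {σ : Perm (ZMod n)} (hσ : σ ∈ ({π, ρ} : Finset _)) {k : Perm V}
      (hk : e.permCongr k = crossMatching σ) : k ∈ univ.image G := by
    refine mem_image.2 ⟨Sum.inr ⟨σ, mem_erase.2 ⟨fun h' => hφ (h' ▸ hσ), hL hσ⟩⟩, mem_univ _, ?_⟩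
    simp only [G, Sum.elim_inr, ← hk]
    ext v
    simp
  have : Nonempty V := Fintype.card_pos_iff.1 (by omega)
  refine ⟨univ.image G, isOneFactorization_image n G ?_ ?_ ?_, hmem (by simp) hπ,
    hmem (by simp) hρ⟩
  · intro i v
    have key : IsMatching (Sum.elim (foldMatching φ)
        (fun σ : {σ // σ ∈ L.erase φ} => crossMatching σ.1) i) := by
      rcases i with i | σ
      · exact isMatching_foldMatching φ i
      · exact isMatching_crossMatching _
    simp only [G, permCongr_apply, symm_symm, apply_symm_apply, (key _).1, symm_apply_apply,
      true_and]
    intro h'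
    exact (key (e v)).2 (e.symm.injective (by rw [h', symm_apply_apply]))
  · intro i j hij v hv
    simp only [G, permCongr_apply, symm_symm] at hv
    have hv := e.symm.injective hv
    revert hv
    have hav {σ : Perm (ZMod n)} (hσ : σ ∈ L.erase φ) : Avoids φ σ :=
      hLL _ hφL _ (mem_of_mem_erase hσ) (ne_of_mem_erase hσ).symm
    rcases i with i | σ <;> rcases j with j | τ
    · exact avoids_foldMatching φ (fun h' => hij (congrArg Sum.inl h')) _
    · exact avoids_foldMatching_crossMatching (hav τ.2) i _
    · exact (avoids_foldMatching_crossMatching (hav σ.2) j).symm _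
    · exact avoids_crossMatching (hLL _ (mem_of_mem_erase σ.2) _ (mem_of_mem_erase τ.2)
        fun h' => hij (by rw [Subtype.ext h'])) _
  · rw [Fintype.card_sum, hα, Fintype.card_coe, card_erase_of_mem hφL]
    omega

/-! ### Intersecting families and conjugates of one-factorizations -/

theorem IsMatching.conj {V : Type*} {g : Perm V} (hg : IsMatching g) (σ : Perm V) :
    IsMatching (σ * g * σ⁻¹) := by
  intro v
  refine ⟨by simp [(hg _).1], fun h => (hg (σ⁻¹ v)).2 (σ.injective ?_)⟩
  rw [← Perm.mul_apply, ← Perm.mul_apply, h, ← Perm.mul_apply, mul_inv_cancel, Perm.one_apply]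

/-- A family of perfect matchings in which every two members share an edge. -/
structure IsIntersecting {V : Type*} (F : Finset (Perm V)) : Prop where
  isMatching : ∀ g ∈ F, IsMatching g
  exists_eq : ∀ g ∈ F, ∀ h ∈ F, ∃ v, g v = h v

theorem IsIntersecting.card_inter_le_one {V : Type*} [DecidableEq (Perm V)]
    {F C : Finset (Perm V)} (hF : IsIntersecting F) {n : ℕ} (hC : IsOneFactorization n C)
    (σ : Perm V) : (C.filter fun g => σ * g * σ⁻¹ ∈ F).card ≤ 1 := by
  rw [card_le_one]
  intro g hg h hh
  rw [mem_filter] at hg hh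
  by_contra hne
  obtain ⟨v, hv⟩ := hF.exists_eq _ hg.2 _ hh.2
  exact hC.avoids g hg.1 h hh.1 hne (σ⁻¹ v) (σ.injective hv)

/-! ### Counting perfect matchings -/

section Counting

variable {V : Type*} [Fintype V] [DecidableEq V]

instance : DecidablePred (IsMatching (V := V)) := fun g => by
  unfold IsMatching; infer_instance

variable (V) in
/-- The set of all perfect matchings of the complete graph on `V`. -/
def allMatchings : Finset (Perm V) := univ.filter IsMatching

@[simp] theorem mem_allMatchings {g : Perm V} : g ∈ allMatchings V ↔ IsMatching g := by
  simp [allMatchings]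

/-- The matchings thus form one conjugacy class, which gives both their number and the conjugating
permutations needed for averaging. -/
theorem isMatching_iff_cycleType {n : ℕ} (hV : Fintype.card V = 2 * n) {g : Perm V} :
    IsMatching g ↔ g.cycleType = Multiset.replicate n 2 := by
  constructor
  · intro hg
    have h2 : g ^ 2 = 1 := by ext v; simp [pow_two, (hg v).1]
    have h := Perm.cycleType_of_pow_prime_eq_one h2
    have hs : g.support = univ := by ext v; simp [(hg v).2]
    have hsum := Perm.sum_cycleType g
    rw [hs, card_univ, hV, h, Multiset.sum_replicate, smul_eq_mul] at hsum
    rw [h]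
    congr 1
    omega
  · intro h v
    have h2 : g ^ 2 = 1 := by
      rw [Perm.pow_prime_eq_one_iff, h]
      intro c hc
      exact Multiset.eq_of_mem_replicate hc
    have hs : g.support = univ := by
      rw [← card_eq_iff_eq_univ, ← Perm.sum_cycleType, h, Multiset.sum_replicate, hV, smul_eq_mul,
        mul_comm]
    refine ⟨?_, Perm.mem_support.1 (hs ▸ mem_univ v)⟩
    rw [← Perm.mul_apply, ← pow_two, h2, Perm.one_apply]

theorem card_allMatchings {n : ℕ} (hn : 1 ≤ n) (hV : Fintype.card V = 2 * n) :
    (allMatchings V).card = Nat.doubleFactorial (2 * n - 1) := by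
  have h := Perm.card_of_cycleType_mul_eq V (Multiset.replicate n 2)
  have e : (univ.filter fun g : Perm V => g.cycleType = Multiset.replicate n 2) =
      allMatchings V := by
    ext g
    simp [isMatching_iff_cycleType hV]
  rw [e, if_pos ⟨by simp [hV, mul_comm], fun a ha => (Multiset.eq_of_mem_replicate ha).ge⟩,
    Multiset.toFinset_replicate, if_neg (by omega), prod_singleton, Multiset.count_replicate_self,
    Multiset.prod_replicate, Multiset.sum_replicate, hV, smul_eq_mul, mul_comm n 2, Nat.sub_self,
    Nat.factorial_zero, one_mul, ← Nat.doubleFactorial_two_mul] at h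
  obtain ⟨m, rfl⟩ : ∃ m, n = m + 1 := ⟨n - 1, by omega⟩
  -- The class formula now reads `(2n)‼ * |M| = (2n)!`, with `M` the set of matchings; splitting the
  -- factorial as `(2n)‼ * (2n - 1)‼` allows cancellation.
  have h3 := Nat.factorial_eq_mul_doubleFactorial (2 * m + 1)
  have h4 : 2 * (m + 1) - 1 = 2 * m + 1 := by omega
  have h5 : 2 * (m + 1) = 2 * m + 1 + 1 := by omega
  rw [h4]
  rw [h5, h3, mul_comm] at h
  exact Nat.eq_of_mul_eq_mul_left (Nat.doubleFactorial_pos _) h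

/-- At `n = 1` the truncated argument is `0`, and `0‼ = 1` agrees with the convention `(-1)!! = 1`.
-/
theorem doubleFactorial_odd_recursion {n : ℕ} (hn : 1 ≤ n) :
    Nat.doubleFactorial (2 * n - 1) = (2 * n - 1) * Nat.doubleFactorial (2 * (n - 1) - 1) := by
  obtain ⟨m, rfl⟩ : ∃ m, n = m + 1 := ⟨n - 1, by omega⟩
  have h4 : 2 * (m + 1) - 1 = 2 * m + 1 := by omega
  rw [h4, Nat.doubleFactorial_add_one, Nat.add_sub_cancel]

/-- The number of perfect matchings through a given edge. -/
theorem card_star {n : ℕ} (hn : 1 ≤ n) (hV : Fintype.card V = 2 * n) {i j : V} (hij : i ≠ j) :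
    ((allMatchings V).filter fun g => g i = j).card = Nat.doubleFactorial (2 * (n - 1) - 1) := by
  -- The transposition of `j` and `k` carries one star at `i` to the other, so the `2n - 1` stars at
  -- `i` split the matchings evenly.
  have hconst : ∀ k ∈ univ.erase i, ((allMatchings V).filter fun g => g i = k).card =
      ((allMatchings V).filter fun g => g i = j).card := by
    intro k hk
    have hki : k ≠ i := ne_of_mem_erase hk
    refine card_nbij' (fun g => swap j k * g * (swap j k)⁻¹) (fun g => swap j k * g * (swap j k)⁻¹)
      ?_ ?_ ?_ ?_
    · intro g hg
      simp only [coe_filter, Set.mem_ofPred_eq, mem_allMatchings] at hg ⊢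
      refine ⟨hg.1.conj _, ?_⟩
      simp [swap_inv, Perm.mul_apply, swap_apply_of_ne_of_ne hij hki.symm, hg.2]
    · intro g hg
      simp only [coe_filter, Set.mem_ofPred_eq, mem_allMatchings] at hg ⊢
      refine ⟨hg.1.conj _, ?_⟩
      simp [swap_inv, Perm.mul_apply, swap_apply_of_ne_of_ne hij hki.symm, hg.2]
    · intro g _
      ext v
      simp
    · intro g _
      ext v
      simp
  have hsum := card_eq_sum_card_fiberwise (s := allMatchings V) (t := univ.erase i)
    (f := fun g => g i) fun g hg => by
      simp only [coe_erase, coe_univ, Set.mem_sdiff, Set.mem_univ, true_and, Set.mem_singleton_iff]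
      exact ((mem_allMatchings.1 hg) i).2
  rw [sum_congr rfl hconst, sum_const, card_erase_of_mem (mem_univ i), card_univ, hV,
    card_allMatchings hn hV, doubleFactorial_odd_recursion hn, smul_eq_mul] at hsum
  exact (Nat.eq_of_mul_eq_mul_left (by omega) hsum).symm

/-! ### Averaging over conjugates of a one-factorization -/

/-- The number of permutations conjugating `g` to `h` does not depend on the matchings `g`, `h`. -/
theorem card_conjugators {n : ℕ} (hV : Fintype.card V = 2 * n) {g h : Perm V}
    (hg : IsMatching g) (hh : IsMatching h) :
    (allMatchings V).card * (univ.filter fun σ : Perm V => σ * g * σ⁻¹ = h).card =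
      Fintype.card (Perm V) := by
  have hconst : ∀ k ∈ allMatchings V, (univ.filter fun σ : Perm V => σ * g * σ⁻¹ = k).card =
      (univ.filter fun σ : Perm V => σ * g * σ⁻¹ = h).card := by
    intro k hk
    rw [mem_allMatchings] at hk
    obtain ⟨c, hc⟩ := isConj_iff.1 (Perm.isConj_iff_cycleType_eq.2
      (((isMatching_iff_cycleType hV).1 hk).trans ((isMatching_iff_cycleType hV).1 hh).symm))
    refine card_nbij' (fun σ => c * σ) (fun σ => c⁻¹ * σ) ?_ ?_ ?_ ?_
    · intro σ hσ
      simp only [coe_filter, mem_univ, true_and, Set.mem_ofPred_eq] at hσ ⊢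
      rw [← hc, ← hσ]
      group
    · intro σ hσ
      simp only [coe_filter, mem_univ, true_and, Set.mem_ofPred_eq] at hσ ⊢
      have : k = c⁻¹ * h * c := by rw [← hc]; group
      rw [this, ← hσ]
      group
    · intro σ _; simp
    · intro σ _; simp
  have hsum := card_eq_sum_card_fiberwise (s := (univ : Finset (Perm V))) (t := allMatchings V)
    (f := fun σ => σ * g * σ⁻¹) fun σ _ => by simpa using hg.conj σ
  rw [sum_congr rfl hconst, sum_const, smul_eq_mul, card_univ] at hsum
  exact hsum.symm

/-- Double counting of the triples `(σ, g, h)` with `g ∈ C`, `h ∈ F` and `σ * g * σ⁻¹ = h`. -/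
theorem sum_card_conj_mem {n : ℕ} (hV : Fintype.card V = 2 * n) {F C : Finset (Perm V)}
    (hF : IsIntersecting F) (hC : IsOneFactorization n C) :
    (allMatchings V).card * ∑ σ : Perm V, (C.filter fun g => σ * g * σ⁻¹ ∈ F).card =
      (2 * n - 1) * F.card * Fintype.card (Perm V) := by
  have h1 : ∑ σ : Perm V, (C.filter fun g => σ * g * σ⁻¹ ∈ F).card =
      ∑ g ∈ C, ∑ h ∈ F, (univ.filter fun σ : Perm V => σ * g * σ⁻¹ = h).card := by
    have h2 (g : Perm V) : ∑ h ∈ F, (univ.filter fun σ : Perm V => σ * g * σ⁻¹ = h).card =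
        (univ.filter fun σ : Perm V => σ * g * σ⁻¹ ∈ F).card := by
      rw [card_eq_sum_card_fiberwise (s := univ.filter fun σ : Perm V => σ * g * σ⁻¹ ∈ F) (t := F)
        (f := fun σ => σ * g * σ⁻¹) fun σ hσ => by simpa using hσ]
      refine sum_congr rfl fun h hh => congrArg card ?_
      ext σ
      simp only [mem_filter, mem_univ, true_and]
      exact ⟨fun e => ⟨e ▸ hh, e⟩, And.right⟩
    simp_rw [h2]
    exact sum_card_bipartiteAbove_eq_sum_card_bipartiteBelow fun σ g : Perm V => σ * g * σ⁻¹ ∈ F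
  rw [h1, mul_sum]
  have h3 : ∀ g ∈ C, (allMatchings V).card *
      ∑ h ∈ F, (univ.filter fun σ : Perm V => σ * g * σ⁻¹ = h).card =
      F.card * Fintype.card (Perm V) := by
    intro g hg
    rw [mul_sum, sum_congr rfl fun h hh =>
      card_conjugators hV (hC.isMatching g hg) (hF.isMatching h hh), sum_const, smul_eq_mul]
  rw [sum_congr rfl h3, sum_const, hC.card_eq, smul_eq_mul, mul_assoc]

theorem IsIntersecting.card_le_of_isOneFactorization {n : ℕ} (hn : 1 ≤ n)
    (hV : Fintype.card V = 2 * n) {F C : Finset (Perm V)}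
    (hF : IsIntersecting F) (hC : IsOneFactorization n C) :
    F.card ≤ Nat.doubleFactorial (2 * (n - 1) - 1) := by
  have h := sum_card_conj_mem hV hF hC
  have h1 : ∑ σ : Perm V, (C.filter fun g => σ * g * σ⁻¹ ∈ F).card ≤ Fintype.card (Perm V) := by
    refine (sum_le_card_nsmul _ _ 1 fun σ _ => hF.card_inter_le_one hC σ).trans_eq ?_
    rw [card_univ, smul_eq_mul, mul_one]
  have h2 := Nat.mul_le_mul_left (allMatchings V).card h1
  rw [h] at h2
  have h3 := Nat.le_of_mul_le_mul_right h2 Fintype.card_pos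
  rw [card_allMatchings hn hV, doubleFactorial_odd_recursion hn] at h3
  exact Nat.le_of_mul_le_mul_left h3 (by omega)

/-- An intersecting family of maximum size meets every one-factorization. -/
theorem IsIntersecting.exists_mem_of_card_eq {n : ℕ} (hn : 1 ≤ n)
    (hV : Fintype.card V = 2 * n) {F C : Finset (Perm V)}
    (hF : IsIntersecting F) (hC : IsOneFactorization n C)
    (hcard : F.card = Nat.doubleFactorial (2 * (n - 1) - 1)) : ∃ g ∈ C, g ∈ F := by
  by_contra hno
  push Not at hno
  have h := sum_card_conj_mem hV hF hC
  have h1 : ∑ σ : Perm V, (C.filter fun g => σ * g * σ⁻¹ ∈ F).card < Fintype.card (Perm V) := by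
    have : Fintype.card (Perm V) = ∑ _σ : Perm V, 1 := by simp
    rw [this]
    -- The identity contributes `0`, so the average would drop below `1`, whereas the size of `F`
    -- makes it exactly `1`.
    refine sum_lt_sum (fun σ _ => hF.card_inter_le_one hC σ) ⟨1, mem_univ _, ?_⟩
    rw [Nat.lt_one_iff, card_eq_zero, filter_eq_empty_iff]
    intro g hg
    simpa using hno g hg
  rw [hcard, ← doubleFactorial_odd_recursion hn, ← card_allMatchings hn hV] at h
  have h2 : 0 < (allMatchings V).card := by
    rw [card_allMatchings hn hV]
    exact Nat.doubleFactorial_pos _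
  exact h1.ne (Nat.eq_of_mul_eq_mul_left h2 h)

end Counting

theorem IsMatching.apply_eq_iff {V : Type*} {g : Perm V} (hg : IsMatching g) {v w : V} : g v = w ↔ v = g w :=
  ⟨fun e => by rw [← e, (hg v).1], fun e => by rw [e, (hg w).1]⟩

/-! ### Switching two edges of a perfect matching -/

section Switch

variable {V : Type*} [DecidableEq V] {g h : Perm V} {a b : V}

/-- Replace the edges `{a, g a}`, `{b, g b}` of `g` by `{a, b}`, `{g a, g b}`. -/
def switchEdges (g : Perm V) (a b : V) : Perm V := swap (g a) b * g * (swap (g a) b)⁻¹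

theorem isMatching_switchEdges (hg : IsMatching g) (a b : V) :
    IsMatching (switchEdges g a b) :=
  hg.conj _

theorem IsMatching.switchEdges_fst (hg : IsMatching g) (hba : b ≠ a) :
    switchEdges g a b a = b := by
  simp [switchEdges, swap_apply_of_ne_of_ne (hg a).2.symm hba.symm]

theorem IsMatching.switchEdges_snd (hg : IsMatching g) (hba : b ≠ a) :
    switchEdges g a b b = a := by
  simp [switchEdges, (hg a).1,
    swap_apply_of_ne_of_ne (hg a).2.symm hba.symm]

theorem IsMatching.switchEdges_partner_fst (hg : IsMatching g) (hba : b ≠ a) :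
    switchEdges g a b (g a) = g b := by
  simp [switchEdges,
    swap_apply_of_ne_of_ne (g.injective.ne hba) (hg b).2]

theorem IsMatching.switchEdges_partner_snd (hg : IsMatching g) (hba : b ≠ a) :
    switchEdges g a b (g b) = g a := by
  simp [switchEdges, (hg b).1,
    swap_apply_of_ne_of_ne (g.injective.ne hba) (hg b).2]

theorem IsMatching.switchEdges_of_ne (hg : IsMatching g) {v : V} (h1 : v ≠ a) (h2 : v ≠ b)
    (h3 : v ≠ g a) (h4 : v ≠ g b) : switchEdges g a b v = g v := by
  have h5 : g v ≠ b := by rwa [Ne, hg.apply_eq_iff]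
  simp [switchEdges, swap_apply_of_ne_of_ne h3 h2,
    swap_apply_of_ne_of_ne (g.injective.ne h1) h5]

theorem IsMatching.switchEdges_cases (hg : IsMatching g) (a b : V) {P : V → Prop}
    (h1 : P a) (h2 : P b) (h3 : P (g a)) (h4 : P (g b))
    (h5 : ∀ v, switchEdges g a b v = g v → v ≠ a → v ≠ b → v ≠ g a → v ≠ g b → P v) (v : V) :
    P v := by
  by_cases e1 : v = a
  · exact e1 ▸ h1
  by_cases e2 : v = b
  · exact e2 ▸ h2
  by_cases e3 : v = g a
  · exact e3 ▸ h3
  by_cases e4 : v = g b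
  · exact e4 ▸ h4
  exact h5 v (hg.switchEdges_of_ne e1 e2 e3 e4) e1 e2 e3 e4

variable [Fintype V] {n : ℕ}

/-- Exchange, in a one-factorization through `g` and a switch of `h`, the two edges at `a, b`. -/
theorem exists_isOneFactorization_switch (hn : 3 ≤ n) (hV : Fintype.card V = 2 * n)
    (hg : IsMatching g) (hh : IsMatching h) (hba : b ≠ a) (hbg : b ≠ g a)
    (ha : h a = g a) (hb : h b = g b)
    (hne : ∀ v, v ≠ a → v ≠ b → v ≠ g a → v ≠ g b → h v ≠ g v) :
    ∃ C : Finset (Perm V), IsOneFactorization n C ∧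
      ∀ k ∈ C, k = switchEdges g a b ∨ k = h ∨ Avoids g k := by
  have hgb : g b ≠ a := by
    rw [Ne, hg.apply_eq_iff]; exact hbg
  have h1 := hh.switchEdges_fst hba
  have h2 := hh.switchEdges_snd hba
  have h3 := hh.switchEdges_partner_fst hba
  have h4 := hh.switchEdges_partner_snd hba
  have g1 := hg.switchEdges_fst hba
  have g2 := hg.switchEdges_snd hba
  have g3 := hg.switchEdges_partner_fst hba
  have g4 := hg.switchEdges_partner_snd hba
  rw [ha, hb] at h3 h4
  have h5 (v : V) (e1 : v ≠ a) (e2 : v ≠ b) (e3 : v ≠ g a) (e4 : v ≠ g b) :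
      switchEdges h a b v = h v :=
    hh.switchEdges_of_ne e1 e2 (by rwa [ha]) (by rwa [hb])
  have hga : h (g a) = a := by rw [← ha, (hh a).1]
  have hgb' : h (g b) = b := by rw [← hb, (hh b).1]
  have gga := (hg a).1
  have ggb := (hg b).1
  have hav : Avoids g (switchEdges h a b) := by
    refine hg.switchEdges_cases a b ?_ ?_ ?_ ?_ ?_
    · rw [h1]; exact hbg.symm
    · rw [h2]; exact hgb
    · rw [h3, gga]; exact hgb.symm
    · rw [h4, ggb]; exact hbg
    · intro v _ e1 e2 e3 e4
      rw [h5 v e1 e2 e3 e4]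
      exact (hne v e1 e2 e3 e4).symm
  have hav' : Avoids (switchEdges g a b) h := by
    refine hg.switchEdges_cases a b ?_ ?_ ?_ ?_ ?_
    · rw [g1, ha]; exact hbg
    · rw [g2, hb]; exact hgb.symm
    · rw [g3, hga]; exact hgb
    · rw [g4, hgb']; exact hbg.symm
    · intro v e e1 e2 e3 e4
      rw [e]
      exact (hne v e1 e2 e3 e4).symm
  -- Both new matchings use only edges of the two they replace, hence stay disjoint from the rest of
  -- `C`.
  have hcg : ∀ v, switchEdges g a b v = g v ∨ switchEdges g a b v = switchEdges h a b v := by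
    refine hg.switchEdges_cases a b ?_ ?_ ?_ ?_ ?_
    · right; rw [g1, h1]
    · right; rw [g2, h2]
    · right; rw [g3, h3]
    · right; rw [g4, h4]
    · exact fun v e _ _ _ _ => Or.inl e
  have hch : ∀ v, h v = g v ∨ h v = switchEdges h a b v := by
    refine hg.switchEdges_cases a b ?_ ?_ ?_ ?_ ?_
    · exact Or.inl ha
    · exact Or.inl hb
    · left; rw [hga, gga]
    · left; rw [hgb', ggb]
    · exact fun v _ e1 e2 e3 e4 => Or.inr (h5 v e1 e2 e3 e4).symm
  obtain ⟨C, hC, hgC, hkC⟩ := exists_isOneFactorization hV hg (isMatching_switchEdges hh a b)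
    (fun _ => hav) (lt_of_le_of_lt card_le_two hn)
  have hgk : g ≠ switchEdges h a b := fun e => hav a (congrArg (fun p : Perm V => p a) e)
  have hgs : switchEdges g a b ≠ h := fun e => hav' a (congrArg (fun p : Perm V => p a) e)
  let C' := (C.erase g).erase (switchEdges h a b)
  have hC' {k : Perm V} (hk : k ∈ C') : k ∈ C ∧ Avoids g k ∧ Avoids (switchEdges h a b) k := by
    rw [mem_erase, mem_erase] at hk
    exact ⟨hk.2.2, hC.avoids g hgC k hk.2.2 hk.2.1.symm, hC.avoids _ hkC k hk.2.2 hk.1.symm⟩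
  have hsC' {k : Perm V} (hk : k ∈ C') : Avoids (switchEdges g a b) k := fun v => by
    rcases hcg v with e | e <;> rw [e]
    · exact (hC' hk).2.1 v
    · exact (hC' hk).2.2 v
  have hhC' {k : Perm V} (hk : k ∈ C') : Avoids h k := fun v => by
    rcases hch v with e | e <;> rw [e]
    · exact (hC' hk).2.1 v
    · exact (hC' hk).2.2 v
  refine ⟨insert (switchEdges g a b) (insert h C'), ⟨?_, ?_, ?_⟩, ?_⟩
  · intro k hk
    rw [mem_insert, mem_insert] at hk
    rcases hk with rfl | rfl | hk
    · exact isMatching_switchEdges hg a b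
    · exact hh
    · exact hC.isMatching k (hC' hk).1
  · intro k hk l hl hkl
    rw [mem_insert, mem_insert] at hk hl
    rcases hk with rfl | rfl | hk <;> rcases hl with rfl | rfl | hl
    · exact absurd rfl hkl
    · exact hav'
    · exact hsC' hl
    · exact hav'.symm
    · exact absurd rfl hkl
    · exact hhC' hl
    · exact (hsC' hk).symm
    · exact (hhC' hk).symm
    · exact hC.avoids k (hC' hk).1 l (hC' hl).1 hkl
  · rw [card_insert_of_notMem, card_insert_of_notMem, card_erase_of_mem, card_erase_of_mem hgC,
      hC.card_eq]
    · omega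
    · exact mem_erase.2 ⟨hgk.symm, hkC⟩
    · exact fun hk => hhC' hk a rfl
    · rw [mem_insert]
      rintro (e | hk)
      · exact hgs e
      · exact hsC' hk a rfl
  · intro k hk
    rw [mem_insert, mem_insert] at hk
    rcases hk with rfl | rfl | hk
    · exact Or.inl rfl
    · exact Or.inr (Or.inl rfl)
    · exact Or.inr (Or.inr (hC' hk).2.1)

/-- A member agreeing with the involution `f` at `v` also agrees at its partner. If all did, `2n -
1` disjoint vertex sets of size at least `2` would fit into `2n` vertices. -/
theorem IsOneFactorization.exists_avoids {C : Finset (Perm V)} (hC : IsOneFactorization n C)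
    (hn : 2 ≤ n) (hV : Fintype.card V = 2 * n) (f : V → V) (hf : ∀ v w, f v = w → f w = v) :
    ∃ k ∈ C, ∀ v, k v ≠ f v := by
  by_contra hno
  push Not at hno
  have h2 : ∀ k ∈ C, 2 ≤ (univ.filter fun v => k v = f v).card := by
    intro k hk
    obtain ⟨v, hv⟩ := hno k hk
    have hkm := hC.isMatching k hk
    rw [← card_pair (hkm v).2.symm]
    apply card_le_card
    intro w hw
    rw [mem_insert, mem_singleton] at hw
    rcases hw with rfl | rfl
    · simpa using hv
    · simp [(hkm v).1, hf v _ hv.symm]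
  have h3 : ∑ k ∈ C, (univ.filter fun v => k v = f v).card ≤ Fintype.card V := by
    rw [← card_univ, ← card_biUnion]
    · exact card_le_card (subset_univ _)
    · intro k hk l hl hkl
      rw [Function.onFun, disjoint_left]
      intro v hv hv'
      simp only [mem_filter, mem_univ, true_and] at hv hv'
      exact hC.avoids k hk l hl hkl v (hv.trans hv'.symm)
  have h4 := card_nsmul_le_sum C _ 2 h2
  rw [hC.card_eq, smul_eq_mul] at h4
  omega

/-- There is a matching that shares exactly the edges at `a`, `b` with `g`, and shares none with
`m`. -/
theorem exists_matching_avoiding (hn : 4 ≤ n) (hV : Fintype.card V = 2 * n)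
    {m : Perm V} (hg : IsMatching g) (hm : IsMatching m) (hba : b ≠ a) (hbg : b ≠ g a)
    (ha : m a ≠ g a) (hb : m b ≠ g b) (hgm : ∃ v, g v = m v) :
    ∃ h : Perm V, IsMatching h ∧ h a = g a ∧ h b = g b ∧
      (∀ v, v ≠ a → v ≠ b → v ≠ g a → v ≠ g b → h v ≠ g v) ∧ Avoids h m := by
  have hgb : g b ≠ a := by
    rw [Ne, hg.apply_eq_iff]; exact hbg
  let p : V → Prop := fun v => v ∉ ({a, b, g a, g b} : Finset V)
  have hp (v : V) : p v ↔ v ≠ a ∧ v ≠ b ∧ v ≠ g a ∧ v ≠ g b := by simp [p]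
  have hpg (v : V) : p (g v) ↔ p v := by
    rw [hp, hp, Ne, hg.apply_eq_iff, Ne, hg.apply_eq_iff, Ne, g.injective.eq_iff, Ne,
      g.injective.eq_iff]
    tauto
  have hW : Fintype.card {v // p v} = 2 * (n - 2) := by
    have h4 : ({a, b, g a, g b} : Finset V).card = 4 := by
      rw [card_insert_of_notMem, card_insert_of_notMem, card_pair (g.injective.ne hba.symm)]
      · simp only [mem_insert, mem_singleton, not_or]
        exact ⟨hbg, (hg b).2.symm⟩
      · simp only [mem_insert, mem_singleton, not_or]
        exact ⟨hba.symm, (hg a).2.symm, hgb.symm⟩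
    have h5 : Fintype.card {v // p v} = (({a, b, g a, g b} : Finset V)ᶜ).card :=
      Fintype.card_of_subtype _ fun v => by rw [mem_compl]
    rw [h5, card_compl, h4, hV]
    omega
  have hg' : IsMatching (g.subtypePerm hpg) := fun v =>
    ⟨Subtype.ext (hg v).1, fun e => (hg v).2 (congrArg Subtype.val e)⟩
  -- Off the two edges `2(n - 2)` vertices remain; `n ≥ 4` gives the `1 < n - 2` required here.
  obtain ⟨C, hC, hgC, -⟩ := exists_isOneFactorization hW hg' hg' (fun e => absurd rfl e)
    (by simp only [pair_eq_singleton, card_singleton]; omega)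
  -- Where `m` leaves the remaining vertices the default value is `v` itself, which `k` never takes.
  obtain ⟨k, hk, hkm⟩ := hC.exists_avoids (by omega) hW
    (fun v => if hv : p (m v) then ⟨m v, hv⟩ else v) (by
      rintro ⟨v, hv⟩ w rfl
      by_cases h : p (m v)
      · simp [h, (hm v).1, hv]
      · simp [h])
  have hkM := hC.isMatching k hk
  have hkm' (v : {v // p v}) : (k v : V) ≠ m v := by
    intro e
    have hpm : p (m v) := e ▸ (k v).2
    apply hkm v
    rw [dif_pos hpm]
    exact Subtype.ext e
  -- It suffices that `k` is not the restriction of `g`: the edge shared by `g` and `m` lies among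
  -- the remaining vertices, and `k` avoids `m`.
  have hgk : Avoids k (g.subtypePerm hpg) := by
    apply hC.avoids k hk _ hgC
    rintro rfl
    obtain ⟨v, hv⟩ := hgm
    by_cases hpv : p v
    · exact hkm' ⟨v, hpv⟩ hv
    · rw [hp] at hpv
      by_cases e1 : v = a
      · exact ha (e1 ▸ hv.symm)
      by_cases e2 : v = b
      · exact hb (e2 ▸ hv.symm)
      by_cases e3 : v = g a
      · rw [e3, (hg a).1] at hv
        exact ha (hm.apply_eq_iff.2 hv)
      by_cases e4 : v = g b
      · rw [e4, (hg b).1] at hv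
        exact hb (hm.apply_eq_iff.2 hv)
      exact hpv ⟨e1, e2, e3, e4⟩
  let h : Perm V := Perm.subtypeCongr k (g.subtypePerm fun v => not_congr (hpg v))
  have hpos (v : V) (hv : p v) : h v = k ⟨v, hv⟩ := Perm.subtypeCongr.left_apply _ _ hv
  have hneg (v : V) (hv : ¬ p v) : h v = g v := Perm.subtypeCongr.right_apply _ _ hv
  have hna : ¬ p a := by simp [hp]
  have hnb : ¬ p b := by simp [hp]
  refine ⟨h, ?_, hneg a hna, hneg b hnb, ?_, ?_⟩
  · intro v
    by_cases hv : p v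
    · rw [hpos v hv, hpos _ (k ⟨v, hv⟩).2]
      exact ⟨congrArg Subtype.val (hkM ⟨v, hv⟩).1,
        fun e => (hkM ⟨v, hv⟩).2 (Subtype.ext e)⟩
    · rw [hneg v hv, hneg _ (by rwa [hpg])]
      exact hg v
  · intro v h1 h2 h3 h4
    have hv := (hp v).2 ⟨h1, h2, h3, h4⟩
    rw [hpos v hv]
    exact fun e => hgk ⟨v, hv⟩ (Subtype.ext e)
  · intro v
    by_cases hv : p v
    · rw [hpos v hv]
      exact hkm' ⟨v, hv⟩
    · rw [hneg v hv]
      rw [hp] at hv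
      intro e
      by_cases e1 : v = a
      · exact ha (e1 ▸ e.symm)
      by_cases e2 : v = b
      · exact hb (e2 ▸ e.symm)
      by_cases e3 : v = g a
      · rw [e3, (hg a).1] at e
        exact ha (hm.apply_eq_iff.2 e)
      by_cases e4 : v = g b
      · rw [e4, (hg b).1] at e
        exact hb (hm.apply_eq_iff.2 e)
      exact hv ⟨e1, e2, e3, e4⟩

end Switch

/-! ### Intersecting families of maximum size are stars -/

section Extremal

variable {V : Type*} [Fintype V] [DecidableEq V] {n : ℕ} {F : Finset (Perm V)}

/-- Otherwise the exchanged one-factorization misses `F`: the switch of `g` is excluded by `hs`, `h`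
is disjoint from `m`, and the other members are disjoint from `g`. -/
theorem IsIntersecting.apply_eq_or_of_switchEdges_notMem (hn : 4 ≤ n)
    (hV : Fintype.card V = 2 * n) (hF : IsIntersecting F)
    (hcard : F.card = Nat.doubleFactorial (2 * (n - 1) - 1)) {g m : Perm V} (hg : g ∈ F)
    (hm : m ∈ F) {a b : V} (hba : b ≠ a) (hbg : b ≠ g a) (hs : switchEdges g a b ∉ F) :
    m a = g a ∨ m b = g b := by
  by_contra! hno
  obtain ⟨h, hh, ha, hb, hne, hav⟩ := exists_matching_avoiding hn hV (hF.isMatching g hg)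
    (hF.isMatching m hm) hba hbg hno.1 hno.2 (hF.exists_eq g hg m hm)
  obtain ⟨C, hC, hCk⟩ := exists_isOneFactorization_switch (by omega) hV (hF.isMatching g hg) hh
    hba hbg ha hb hne
  obtain ⟨k, hk, hkF⟩ := hF.exists_mem_of_card_eq (by omega) hV hC hcard
  rcases hCk k hk with rfl | rfl | hgk
  · exact hs hkF
  · obtain ⟨v, hv⟩ := hF.exists_eq k hkF m hm
    exact hav v hv
  · obtain ⟨v, hv⟩ := hF.exists_eq g hg k hkF
    exact hgk v hv

/-- Take `g, h ∈ F` agreeing at the fewest vertices. Switching a common edge of theirs with another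
edge of `g` creates no new agreement and destroys one, so the switch cannot lie in `F`. -/
theorem IsIntersecting.exists_switchEdges_notMem (hn : 2 ≤ n) (hV : Fintype.card V = 2 * n)
    (hF : IsIntersecting F) (hne : F.Nonempty) :
    ∃ g ∈ F, ∃ a b, b ≠ a ∧ b ≠ g a ∧ switchEdges g a b ∉ F := by
  by_contra! hno
  obtain ⟨⟨g, h⟩, hgh, hmin⟩ := exists_min_image (F ×ˢ F)
    (fun p => (univ.filter fun v => p.1 v = p.2 v).card) (hne.product hne)
  rw [mem_product] at hgh
  have hg := hF.isMatching g hgh.1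
  have hh := hF.isMatching h hgh.2
  obtain ⟨a, ha⟩ := hF.exists_eq g hgh.1 h hgh.2
  obtain ⟨b, hb⟩ : ∃ b, b ∉ ({a, g a} : Finset V) := by
    by_contra! hall
    have h1 := card_le_card (fun v _ => hall v : (univ : Finset V) ⊆ _)
    have h2 : ({a, g a} : Finset V).card ≤ 2 := card_le_two
    rw [card_univ] at h1
    omega
  simp only [mem_insert, mem_singleton, not_or] at hb
  obtain ⟨hba, hbg⟩ := hb
  have hgb : g b ≠ a := by rwa [Ne, hg.apply_eq_iff]
  have hmem := hno g hgh.1 a b hba hbg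
  refine (hmin (switchEdges g a b, h) (mem_product.2 ⟨hmem, hgh.2⟩)).not_gt (card_lt_card ?_)
  have ha' : switchEdges g a b a ≠ h a := by rw [hg.switchEdges_fst hba, ← ha]; exact hbg
  refine (ssubset_iff_of_subset ?_).2 ⟨a, by simpa using ha, by simpa using ha'⟩
  have key : ∀ v, switchEdges g a b v = h v → g v = h v := by
    refine hg.switchEdges_cases a b (fun e => absurd e ha') ?_ ?_ ?_ ?_
    · rw [hg.switchEdges_snd hba]
      intro e
      rw [eq_comm, hh.apply_eq_iff, ← ha] at e
      exact absurd e hbg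
    · rw [hg.switchEdges_partner_fst hba, ha, (hh a).1]
      exact fun e => absurd e hgb
    · rw [hg.switchEdges_partner_snd hba, ha]
      intro e
      exact absurd (h.injective e).symm hgb
    · intro v e _ _ _ _ e'
      rw [← e, e']
  intro v hv
  simp only [mem_filter, mem_univ, true_and] at hv ⊢
  exact key v hv

theorem IsIntersecting.exists_star_of_four_le (hn : 4 ≤ n) (hV : Fintype.card V = 2 * n)
    (hF : IsIntersecting F) (hcard : F.card = Nat.doubleFactorial (2 * (n - 1) - 1)) :
    ∃ i j, i ≠ j ∧ ∀ g ∈ F, g i = j := by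
  have hne : F.Nonempty := by
    rw [← card_pos, hcard]
    exact Nat.doubleFactorial_pos _
  obtain ⟨g, hg, a, b, hba, hbg, hs⟩ := hF.exists_switchEdges_notMem (by omega) hV hne
  have hgM := hF.isMatching g hg
  have key : ∀ m ∈ F, m a = g a ∨ m b = g b := fun m hm =>
    hF.apply_eq_or_of_switchEdges_notMem hn hV hcard hg hm hba hbg hs
  by_cases hA : ∀ m ∈ F, m a = g a
  · exact ⟨a, g a, (hgM a).2.symm, hA⟩
  by_cases hB : ∀ m ∈ F, m b = g b
  · exact ⟨b, g b, (hgM b).2.symm, hB⟩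
  exfalso
  push Not at hA hB
  obtain ⟨m, hm, hma⟩ := hA
  obtain ⟨l, hl, hlb⟩ := hB
  have hmb := (key m hm).resolve_left hma
  have hla := (key l hl).resolve_right hlb
  have hlM := hF.isMatching l hl
  -- The switch of `l` contains neither of the two edges of `g`, so the dichotomy also applies to
  -- `l`; but `m` and `l` agree at neither `a` nor `b`.
  have hs' : switchEdges l a b ∉ F := by
    intro hmem
    rcases key _ hmem with e | e
    · rw [hlM.switchEdges_fst hba] at e
      exact hbg e
    · rw [hlM.switchEdges_snd hba, eq_comm, hgM.apply_eq_iff] at e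
      exact hbg e
  rcases hF.apply_eq_or_of_switchEdges_notMem hn hV hcard hl hm hba (by rwa [hla]) hs' with e | e
  · exact hma (e.trans hla)
  · exact hlb (e.symm.trans hmb)

/-- Without a common edge, the edges shared by the three pairs are disjoint and cover all six
vertices. Two of them belong to `f`, so `f` must also contain the third, which `g` and `h` share. -/
theorem exists_common_edge_of_card_eq_six (hV : Fintype.card V = 6) {f g h : Perm V}
    (hf : IsMatching f) (hg : IsMatching g) (hh : IsMatching h) (hfg : ∃ v, f v = g v)
    (hfh : ∃ v, f v = h v) (hgh : ∃ v, g v = h v) : ∃ v, f v = g v ∧ f v = h v := by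
  by_contra! hno
  obtain ⟨x, hx⟩ := hfg
  obtain ⟨y, hy⟩ := hfh
  obtain ⟨z, hz⟩ := hgh
  have fx : f (f x) = g (f x) := by rw [(hf x).1, hx, (hg x).1]
  have fy : f (f y) = h (f y) := by rw [(hf y).1, hy, (hh y).1]
  have gz : g (g z) = h (g z) := by rw [(hg z).1, hz, (hh z).1]
  have hxy {u v : V} (hu : f u = g u) (hv : f v = h v) : u ≠ v := fun e => hno u hu (e ▸ hv)
  have hxz {u v : V} (hu : f u = g u) (hv : g v = h v) : u ≠ v := fun e =>
    hno u hu (hu.trans (e ▸ hv))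
  have hyz {u v : V} (hu : f u = h u) (hv : g v = h v) : u ≠ v := fun e =>
    hno u (hu.trans (e ▸ hv).symm) hu
  have hcard : ({x, f x, y, f y, z, g z} : Finset V).card = 6 := by
    rw [card_insert_of_notMem, card_insert_of_notMem, card_insert_of_notMem,
      card_insert_of_notMem, card_pair (hg z).2.symm]
    · simp only [mem_insert, mem_singleton, not_or]
      exact ⟨hyz fy hz, hyz fy gz⟩
    · simp only [mem_insert, mem_singleton, not_or]
      exact ⟨(hf y).2.symm, hyz hy hz, hyz hy gz⟩
    · simp only [mem_insert, mem_singleton, not_or]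
      exact ⟨hxy fx hy, hxy fx fy, hxz fx hz, hxz fx gz⟩
    · simp only [mem_insert, mem_singleton, not_or]
      exact ⟨(hf x).2.symm, hxy hx hy, hxy hx fy, hxz hx hz, hxz hx gz⟩
  have huniv : ({x, f x, y, f y, z, g z} : Finset V) = univ := by
    rw [← card_eq_iff_eq_univ, hcard, hV]
  have hfz : f z ∈ ({x, f x, y, f y, z, g z} : Finset V) := huniv ▸ mem_univ _
  simp only [mem_insert, mem_singleton] at hfz
  rcases hfz with e | e | e | e | e | e
  · exact hxz fx hz (hf.apply_eq_iff.1 e).symm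
  · exact hxz hx hz (f.injective e).symm
  · exact hyz fy hz (hf.apply_eq_iff.1 e).symm
  · exact hyz hy hz (f.injective e).symm
  · exact (hf z).2 e
  · exact hxz e hz rfl

theorem IsIntersecting.exists_star (hn : 1 ≤ n) (hV : Fintype.card V = 2 * n)
    (hF : IsIntersecting F) (hcard : F.card = Nat.doubleFactorial (2 * (n - 1) - 1)) :
    ∃ i j, i ≠ j ∧ ∀ g ∈ F, g i = j := by
  rcases le_or_gt 4 n with h4 | h4
  · exact hF.exists_star_of_four_le h4 hV hcard
  have : Nonempty V := Fintype.card_pos_iff.1 (by omega)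
  have hone (h1 : F.card = 1) : ∃ i j, i ≠ j ∧ ∀ g ∈ F, g i = j := by
    obtain ⟨g, rfl⟩ := card_eq_one.1 h1
    let v : V := Classical.arbitrary V
    exact ⟨v, g v, (hF.isMatching g (mem_singleton_self g) v).2.symm,
      fun h hh => by rw [mem_singleton.1 hh]⟩
  -- For `n ≤ 2` the bound is `1`; for `n = 3` it is `3`, so `F` consists of three pairwise
  -- intersecting matchings.
  interval_cases n
  · exact hone hcard
  · exact hone hcard
  · obtain ⟨f, g, h, -, -, -, rfl⟩ := card_eq_three.1 (hcard.trans (by decide : _ = 3))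
    have hf' : f ∈ ({f, g, h} : Finset (Perm V)) := by simp
    have hg' : g ∈ ({f, g, h} : Finset (Perm V)) := by simp
    have hh' : h ∈ ({f, g, h} : Finset (Perm V)) := by simp
    obtain ⟨v, h1, h2⟩ := exists_common_edge_of_card_eq_six hV (hF.isMatching f hf')
      (hF.isMatching g hg') (hF.isMatching h hh') (hF.exists_eq f hf' g hg')
      (hF.exists_eq f hf' h hh') (hF.exists_eq g hg' h hh')
    refine ⟨v, f v, (hF.isMatching f hf' v).2.symm, fun k hk => ?_⟩
    simp only [mem_insert, mem_singleton] at hk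
    rcases hk with rfl | rfl | rfl
    · rfl
    · exact h1.symm
    · exact h2.symm

theorem IsIntersecting.card_le (hn : 1 ≤ n) (hV : Fintype.card V = 2 * n)
    (hF : IsIntersecting F) : F.card ≤ Nat.doubleFactorial (2 * (n - 1) - 1) := by
  rcases F.eq_empty_or_nonempty with rfl | ⟨g, hg⟩
  · simp
  have hgM := hF.isMatching g hg
  -- For `n = 1` the general construction has no row to spare, but the single matching is itself a
  -- one-factorization.
  rcases hn.eq_or_lt with rfl | hn'
  · refine hF.card_le_of_isOneFactorization (C := {g}) le_rfl hV ⟨?_, ?_, rfl⟩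
    · simpa using hgM
    · intro k hk l hl hkl
      exact absurd ((mem_singleton.1 hk).trans (mem_singleton.1 hl).symm) hkl
  · obtain ⟨C, hC, -⟩ := exists_isOneFactorization hV hgM hgM (fun e => absurd rfl e)
      (by simpa using hn')
    exact hF.card_le_of_isOneFactorization hn hV hC

end Extremal

/-! ### Perfect matchings as involutions -/

/-- The involution that sends each vertex to its partner in the perfect matching `m`. -/
noncomputable def partner {n : ℕ} (m : PerfMatching n) : Perm (Fin (2 * n)) :=
  Function.Involutive.toPerm
    (fun v => (SimpleGraph.Subgraph.isPerfectMatching_iff.1 m.2 v).choose) fun v =>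
      ((SimpleGraph.Subgraph.isPerfectMatching_iff.1 m.2 _).choose_spec.2 v
        (SimpleGraph.Subgraph.isPerfectMatching_iff.1 m.2 v).choose_spec.1.symm).symm

theorem partner_eq_iff {n : ℕ} {m : PerfMatching n} {v w : Fin (2 * n)} :
    partner m v = w ↔ m.1.Adj v w := by
  have h := (SimpleGraph.Subgraph.isPerfectMatching_iff.1 m.2 v).choose_spec
  constructor
  · rintro rfl
    exact h.1
  · exact fun hw => (h.2 w hw).symm

theorem isMatching_partner {n : ℕ} (m : PerfMatching n) : IsMatching (partner m) := fun v =>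
  ⟨Function.Involutive.toPerm_involutive _ v, (partner_eq_iff.1 (rfl : partner m v = _)).ne.symm⟩

theorem partner_injective {n : ℕ} : Function.Injective (partner (n := n)) := by
  intro m m' h
  apply Subtype.ext
  apply SimpleGraph.Subgraph.ext
  · rw [m.2.2.verts_eq_univ, m'.2.2.verts_eq_univ]
  · ext v w
    rw [← partner_eq_iff, ← partner_eq_iff, h]

theorem exists_partner_eq {n : ℕ} {g : Perm (Fin (2 * n))} (hg : IsMatching g) :
    ∃ m, partner m = g := by
  let M : (⊤ : SimpleGraph (Fin (2 * n))).Subgraph :=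
    { verts := Set.univ
      Adj := fun v w => g v = w
      adj_sub := by
        rintro v w rfl
        exact (hg v).2.symm
      edge_vert := fun _ => Set.mem_univ _
      symm := ⟨fun _ _ h => (hg.apply_eq_iff.1 h).symm⟩ }
  have hM : M.IsPerfectMatching :=
    SimpleGraph.Subgraph.isPerfectMatching_iff.2 fun v => ⟨g v, rfl, fun _ h => Eq.symm h⟩
  refine ⟨⟨M, hM⟩, ?_⟩
  ext1 v
  rw [partner_eq_iff]

theorem mem_matchingsThrough {n : ℕ} {m : PerfMatching n} {i j : Fin (2 * n)} :
    m ∈ matchingsThrough i j ↔ partner m i = j := by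
  rw [partner_eq_iff]
  exact SimpleGraph.Subgraph.mem_edgeSet

theorem isIntersecting_image_partner {n : ℕ} {F : Finset (PerfMatching n)}
    (hF : IsIntersectingFamily F) : IsIntersecting (F.image partner) where
  isMatching := by
    simp only [mem_image]
    rintro _ ⟨m, -, rfl⟩
    exact isMatching_partner m
  exists_eq := by
    simp only [mem_image]
    rintro _ ⟨m, hm, rfl⟩ _ ⟨m', hm', rfl⟩
    obtain ⟨e, he, he'⟩ := hF m hm m' hm'
    induction e using Sym2.ind with
    | _ v w =>
      rw [SimpleGraph.Subgraph.mem_edgeSet, ← partner_eq_iff] at he he'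
      exact ⟨v, he.trans he'.symm⟩

end PerfectMatchingEKR

/-! ### The theorem for matchings as subgraphs -/

open PerfectMatchingEKR in
theorem theorem1 (n : ℕ) (hn : 1 ≤ n) (F : Finset (PerfMatching n))
    (hF : IsIntersectingFamily F) :
    F.card ≤ Nat.doubleFactorial (2 * (n - 1) - 1) ∧
      (F.card = Nat.doubleFactorial (2 * (n - 1) - 1) ↔
        ∃ i j : Fin (2 * n), i ≠ j ∧ (F : Set (PerfMatching n)) = matchingsThrough i j) := by
  have hV : Fintype.card (Fin (2 * n)) = 2 * n := Fintype.card_fin _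
  have hI := isIntersecting_image_partner hF
  have hc : (F.image partner).card = F.card := Finset.card_image_of_injective _ partner_injective
  refine ⟨hc ▸ hI.card_le hn hV, fun h => ?_, ?_⟩
  · obtain ⟨i, j, hij, hstar⟩ := hI.exists_star hn hV (hc.trans h)
    have heq : F.image partner =
        (allMatchings (Fin (2 * n))).filter fun g => g i = j := by
      -- A maximum family inside a star has the size of the star, hence fills it.
      refine Finset.eq_of_subset_of_card_le (fun g hg => ?_) ?_
      · exact Finset.mem_filter.2 ⟨mem_allMatchings.2 (hI.isMatching g hg), hstar g hg⟩
      · rw [card_star hn hV hij, hc, h]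
    refine ⟨i, j, hij, ?_⟩
    ext m
    rw [mem_matchingsThrough, Finset.mem_coe, ← partner_injective.mem_finset_image, heq,
      Finset.mem_filter, mem_allMatchings]
    exact and_iff_right (isMatching_partner m)
  · rintro ⟨i, j, hij, hFij⟩
    rw [← hc, ← card_star hn hV hij]
    congr 1
    ext g
    rw [Finset.mem_filter, mem_allMatchings, Finset.mem_image]
    constructor
    · rintro ⟨m, hm, rfl⟩
      rw [← Finset.mem_coe, hFij, mem_matchingsThrough] at hm
      exact ⟨isMatching_partner m, hm⟩
    · rintro ⟨hg, hgi⟩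
      obtain ⟨m, rfl⟩ := exists_partner_eq hg
      exact ⟨m, by rwa [← Finset.mem_coe, hFij, mem_matchingsThrough], rfl⟩
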